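/- For every real number $C$ there is a constant $C'>0$, depending on $C$ only, with the following property. Let $d\ge 0$ and $N\ge 1$ be integers, let $\mu\in\mathbb{R}^d$, let $\Sigma$ be a symmetric positive semidefinite $d\times d$ matrix with eigenvalues $\lambda_1\ge\lambda_2\ge\cdots\ge\lambda_d\ge 0$, let $\delta\in(0,1/2]$, and let $S\ge 0$ be a real number (which may depend on all of $d,N,\mu,\Sigma,\delta,C$). Let $X_1,\dots,X_N$ be independent Gaussian vectors in $\mathbb{R}^d$ with mean $\mu$ and covariance matrix $\Sigma$, let $\widetilde\mu_N=\frac1N\sum_{i=1}^N X_i$ be their empirical mean, and let $\sigma^2(u)=\mathrm{Var}(\langle X_1,u\rangle)$. If, with probability at least $1-\delta$, \[ \langle \widetilde\mu_N-\mu,u\rangle\le C\sqrt{\frac{\sigma^2(u)\log(1/\delta)}{N}}+S \quad\text{for all } u\in\mathbb{R}^d \text{ with } \|u\|=1, \] then \[ S\ge C'\sqrt{\frac{\sum_{i>k_0}\lambda_i}{N}},\qquad\text{where } k_0=1+(2C+\sqrt2)^2\log(1/\delta). \] In particular, if $S=S(d,N,\mu,\Sigma,\delta)\ge 0$ is such that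 the bound holds with probability at least $1-\delta$ for all values of the parameters, then the lower bound on $S$ holds for all $d,N,\mu,\Sigma$ and all $\delta\le 1/2$. -/

import Mathlib

open MeasureTheory ProbabilityTheory
open scoped RealInnerProductSpace

/-- The directional variance `σ²(u) = Var(⟨X, u⟩)` of a random vector `X` with law `ν`. -/
noncomputable def directionalVariance {d : ℕ} (ν : Measure (EuclideanSpace ℝ (Fin d)))
    (u : EuclideanSpace ℝ (Fin d)) : ℝ :=
  Var[fun x => ⟪x, u⟫; ν]

/-- The empirical mean `(1/N) ∑ᵢ Xᵢ` of `N` vectors. -/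
noncomputable def empiricalMean {d N : ℕ} (x : Fin N → EuclideanSpace ℝ (Fin d)) :
    EuclideanSpace ℝ (Fin d) :=
  (1 / (N : ℝ)) • ∑ i, x i

/-- `∑_{i > k} λᵢ`, where `λ₁ ≥ λ₂ ≥ ⋯ ≥ λ_d` are the eigenvalues of the symmetric matrix `A`,
counted with multiplicity, and `k` is a real threshold. Mathlib's `eigenvalues₀` is the
nonincreasing enumeration of the eigenvalues, with indices starting at `0`, whence the `+ 1`. -/
noncomputable def eigenvalueTailSum {d : ℕ} {A : Matrix (Fin d) (Fin d) ℝ} (hA : A.IsHermitian)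
    (k : ℝ) : ℝ :=
  ∑ i : Fin (Fintype.card (Fin d)) with k < (i.val : ℝ) + 1, hA.eigenvalues₀ i

/-! In the eigenbasis the centred empirical mean is `G = ∑ √(a i) * g i * b i`, with `a i = λᵢ / N`
and `g` standard Gaussian. Let `s` be the largest tail value of `a` and `T` the tail sum. One random
direction, which truncates the spectrum at `s`, turns the assumed bound into `√Q ≤ max C 0 * √(L *
s) + S`, where `Q = ∑ min (a i) s * g i ^ 2` and `L = log (1 / δ)` (`sqrt_sum_min_mul_sq_le`). The
mean of `Q` is at least `m * s + T`, where `m` counts the indices outside the tail. If `S < √T / 4`,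
the bound would force `Q` far below this mean. A Chernoff bound gives that probability less than `1
/ 2` (`measureReal_pi_gaussianReal_sum_mul_sq_le`, `threshold_exponent_lt`), whereas the assumption
grants at least `1 - δ ≥ 1 / 2`. -/

/-! ### Lower tail of weighted chi-square sums. -/

/-- The one-dimensional Laplace transform of `g ^ 2` at `-3 / 2 * t`. -/
lemma integral_exp_neg_mul_sq_gaussianReal {s : ℝ} (hs : 0 ≤ s) :
    ∫ x, Real.exp (-s * x ^ 2) ∂(gaussianReal 0 1) = 1 / √(1 + 2 * s) := by
  rw [integral_gaussianReal_eq_integral_smul one_ne_zero]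
  have h : ∀ x : ℝ, gaussianPDFReal 0 1 x • Real.exp (-s * x ^ 2)
      = (√(2 * Real.pi))⁻¹ * Real.exp (-(1 / 2 + s) * x ^ 2) := by
    intro x
    simp only [gaussianPDFReal, smul_eq_mul, NNReal.coe_one, mul_one, sub_zero]
    rw [mul_assoc, ← Real.exp_add]
    ring_nf
  simp_rw [h]
  rw [integral_const_mul, integral_gaussian, ← Real.sqrt_inv, ← Real.sqrt_mul (by positivity),
    one_div (√_), ← Real.sqrt_inv]
  congr 1
  have := Real.pi_pos
  field_simp

/-- By convexity, `exp` lies below its chord on `[0, 2 log 2]`, and that chord is `1 + 3 * t`. -/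
lemma inv_sqrt_one_add_three_mul_le {t : ℝ} (h0 : 0 ≤ t) (h1 : t ≤ 1) :
    1 / √(1 + 3 * t) ≤ Real.exp (-(Real.log 2 * t)) := by
  have hexp : Real.exp (2 * Real.log 2 * t) ≤ 1 + 3 * t := by
    have h := convexOn_exp.2 (Set.mem_univ 0) (Set.mem_univ (2 * Real.log 2))
      (sub_nonneg.2 h1) h0 (by ring)
    have h4 : Real.exp (2 * Real.log 2) = 4 := by
      rw [two_mul, Real.exp_add, Real.exp_log two_pos]; norm_num
    simp only [smul_eq_mul, mul_zero, zero_add, Real.exp_zero, h4] at h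
    rw [mul_comm]
    linarith
  rw [Real.exp_neg, one_div]
  apply inv_anti₀ (Real.exp_pos _)
  apply Real.le_sqrt_of_sq_le
  rw [sq, ← Real.exp_add]
  convert hexp using 2
  ring

/-- Chernoff bound for the lower tail of a weighted sum of squares of independent standard
Gaussian variables. -/
lemma measureReal_pi_gaussianReal_sum_mul_sq_le {ι : Type*} [Fintype ι] {t : ι → ℝ}
    (h0 : ∀ i, 0 ≤ t i) (h1 : ∀ i, t i ≤ 1) (q : ℝ) :
    (Measure.pi fun _ : ι => gaussianReal 0 1).real {g | ∑ i, t i * g i ^ 2 ≤ q} ≤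
      Real.exp (3 / 2 * q - Real.log 2 * ∑ i, t i) := by
  set ν := Measure.pi fun _ : ι => gaussianReal 0 1
  have hint : Integrable (fun g : ι → ℝ => Real.exp (-(3 / 2) * ∑ i, t i * g i ^ 2)) ν := by
    refine Integrable.of_bound (Measurable.aestronglyMeasurable (by fun_prop)) 1 (ae_of_all _ fun g => ?_)
    rw [Real.norm_of_nonneg (Real.exp_nonneg _), Real.exp_le_one_iff]
    have : 0 ≤ ∑ i, t i * g i ^ 2 := Finset.sum_nonneg fun i _ => mul_nonneg (h0 i) (sq_nonneg _)
    linarith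
  -- At `-3/2` a squared standard Gaussian has Laplace transform `1 / √4 = 1 / 2`, the source of the
  -- factor `log 2`.
  refine (measure_le_le_exp_mul_mgf q (t := -(3 / 2)) (by norm_num) hint).trans ?_
  have hmgf : mgf (fun g : ι → ℝ => ∑ i, t i * g i ^ 2) ν (-(3 / 2)) =
      ∏ i, ∫ x, Real.exp (-(3 / 2 * t i) * x ^ 2) ∂(gaussianReal 0 1) := by
    rw [← integral_fintype_prod_eq_prod (μ := fun _ : ι => gaussianReal 0 1)
      (f := fun i (x : ℝ) => Real.exp (-(3 / 2 * t i) * x ^ 2)), mgf]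
    congr with g
    simp only [← Real.exp_sum, Finset.mul_sum]
    congr 1
    exact Finset.sum_congr rfl fun i _ => by ring
  rw [hmgf, sub_eq_add_neg, Real.exp_add, Finset.mul_sum, ← Finset.sum_neg_distrib, Real.exp_sum]
  refine mul_le_mul (by rw [neg_neg]) (Finset.prod_le_prod (fun i _ => ?_) fun i _ => ?_)
    (Finset.prod_nonneg fun i _ => integral_nonneg fun x => Real.exp_nonneg _) (Real.exp_nonneg _)
  · exact integral_nonneg fun x => Real.exp_nonneg _
  · rw [integral_exp_neg_mul_sq_gaussianReal (mul_nonneg (by norm_num) (h0 i))]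
    rw [show 1 + 2 * (3 / 2 * t i) = 1 + 3 * t i by ring]
    exact inv_sqrt_one_add_three_mul_le (h0 i) (h1 i)

/-! ### Gaussian laws in the eigenbasis. -/

/-- The quadratic form of a symmetric matrix in its eigenbasis. -/
lemma dotProduct_mulVec_eq_sum_eigenvalues {n : Type*} [Fintype n] [DecidableEq n]
    {A : Matrix n n ℝ} (hA : A.IsHermitian) (x : EuclideanSpace ℝ n) :
    x.ofLp ⬝ᵥ A.mulVec x.ofLp = ∑ i, hA.eigenvalues i * ⟪hA.eigenvectorBasis i, x⟫ ^ 2 := by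
  have h1 : ∀ y : EuclideanSpace ℝ n, x.ofLp ⬝ᵥ y.ofLp = ⟪x, y⟫ := fun y => by
    rw [EuclideanSpace.inner_eq_star_dotProduct, dotProduct_comm]; rfl
  have h2 := h1 (WithLp.toLp 2 (A.mulVec x.ofLp))
  rw [h2, ← hA.eigenvectorBasis.sum_inner_mul_inner]
  refine Finset.sum_congr rfl fun i _ => ?_
  have h3 : ⟪hA.eigenvectorBasis i, WithLp.toLp 2 (A.mulVec x.ofLp)⟫
      = hA.eigenvalues i * ⟪hA.eigenvectorBasis i, x⟫ := by
    rw [EuclideanSpace.inner_eq_star_dotProduct, EuclideanSpace.inner_eq_star_dotProduct]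
    simp only [star_trivial]
    rw [dotProduct_comm, Matrix.dotProduct_mulVec, ← Matrix.mulVec_transpose,
      show A.transpose = A by simpa using hA.eq, hA.mulVec_eigenvectorBasis, smul_dotProduct,
      dotProduct_comm, smul_eq_mul]
  rw [h3, real_inner_comm]
  ring

lemma directionalVariance_multivariateGaussian {d : ℕ} (μ : EuclideanSpace ℝ (Fin d))
    {V : Matrix (Fin d) (Fin d) ℝ} (hV : V.PosSemidef) (u : EuclideanSpace ℝ (Fin d)) :
    directionalVariance (multivariateGaussian μ V) u =
      ∑ i, hV.isHermitian.eigenvalues i * ⟪hV.isHermitian.eigenvectorBasis i, u⟫ ^ 2 := by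
  rw [← dotProduct_mulVec_eq_sum_eigenvalues, ← covarianceBilin_multivariateGaussian (μ := μ) hV,
    covarianceBilin_self IsGaussian.memLp_two_id, directionalVariance]
  simp_rw [real_inner_comm]

/-- The characteristic function of `c + ∑ i, a i * g i * b i`, where `g` is standard Gaussian and
`b` is an orthonormal basis. -/
lemma charFun_map_pi_gaussianReal {ι E : Type*} [Fintype ι] [NormedAddCommGroup E]
    [InnerProductSpace ℝ E] [MeasurableSpace E] [BorelSpace E] [SecondCountableTopology E]
    (c : E) (a : ι → ℝ) (b : ι → E) (t : E) :
    charFun ((Measure.pi fun _ : ι => gaussianReal 0 1).map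
      fun g => c + ∑ i, (a i * g i) • b i) t =
      Complex.exp (⟪t, c⟫ * Complex.I - (∑ i, (a i * ⟪b i, t⟫) ^ 2 : ℝ) / 2) := by
  rw [charFun_apply, integral_map (Measurable.aemeasurable (by fun_prop))
    (Measurable.aestronglyMeasurable (by fun_prop))]
  have h : ∀ g : ι → ℝ, Complex.exp (⟪c + ∑ i, (a i * g i) • b i, t⟫ * Complex.I) =
      Complex.exp (⟪t, c⟫ * Complex.I) *
        ∏ i, Complex.exp ((a i * ⟪b i, t⟫ : ℝ) * (g i) * Complex.I) := by
    intro g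
    rw [← Complex.exp_sum, ← Complex.exp_add, inner_add_left, sum_inner, real_inner_comm]
    congr 1
    push_cast
    rw [add_mul, Finset.sum_mul]
    congr 1
    refine Finset.sum_congr rfl fun i _ => ?_
    rw [real_inner_smul_left]
    push_cast
    ring
  simp_rw [h]
  rw [integral_const_mul, integral_fintype_prod_eq_prod
    (f := fun i (x : ℝ) => Complex.exp ((a i * ⟪b i, t⟫ : ℝ) * x * Complex.I))]
  simp_rw [← charFun_apply_real, charFun_gaussianReal]
  rw [← Complex.exp_sum, ← Complex.exp_add]
  congr 1
  push_cast
  rw [sub_eq_add_neg, Finset.sum_div, ← Finset.sum_neg_distrib]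
  congr 1
  refine Finset.sum_congr rfl fun i _ => ?_
  simp

/-- The law of the empirical mean of independent Gaussian vectors, written in the eigenbasis of
the covariance matrix. -/
lemma map_empiricalMean_multivariateGaussian {d N : ℕ} (hN : 0 < N)
    {μ : EuclideanSpace ℝ (Fin d)} {V : Matrix (Fin d) (Fin d) ℝ} (hV : V.PosSemidef)
    {Ω : Type*} [MeasurableSpace Ω] {P : Measure Ω} [IsProbabilityMeasure P]
    {X : Fin N → Ω → EuclideanSpace ℝ (Fin d)}
    (hX : ∀ i, HasLaw (X i) (multivariateGaussian μ V) P) (hind : iIndepFun X P) :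
    P.map (fun ω => empiricalMean fun i => X i ω) =
      (Measure.pi fun _ : Fin d => gaussianReal 0 1).map fun g =>
        μ + ∑ i, (√(hV.isHermitian.eigenvalues i / N) * g i) •
          hV.isHermitian.eigenvectorBasis i := by
  have hm : AEMeasurable (fun ω => ∑ i, X i ω) P :=
    Finset.aemeasurable_fun_sum _ fun i _ => (hX i).aemeasurable
  have hN' : (N : ℂ) ≠ 0 := by exact_mod_cast hN.ne'
  have : IsProbabilityMeasure (P.map (fun ω => empiricalMean fun i => X i ω)) :=
    Measure.isProbabilityMeasure_map (hm.const_smul (1 / (N : ℝ)))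
  have : IsProbabilityMeasure ((Measure.pi fun _ : Fin d => gaussianReal 0 1).map fun g =>
        μ + ∑ i, (√(hV.isHermitian.eigenvalues i / N) * g i) •
          hV.isHermitian.eigenvectorBasis i) :=
    Measure.isProbabilityMeasure_map (Measurable.aemeasurable (by fun_prop))
  apply Measure.ext_of_charFun
  ext t
  rw [charFun_map_pi_gaussianReal]
  simp only [empiricalMean]
  have hs : ∀ r : ℝ, P.map (fun ω => r • ∑ i, X i ω) = (P.map fun ω => ∑ i, X i ω).map (r • ·) :=
    fun r => (AEMeasurable.map_map_of_aemeasurable (by fun_prop) hm).symm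
  rw [hs, charFun_map_smul, hind.charFun_map_fun_sum_eq_prod fun i => (hX i).aemeasurable]
  simp_rw [fun i => (hX i).map_eq]
  rw [Finset.prod_apply]
  simp_rw [charFun_multivariateGaussian hV]
  rw [Finset.prod_const, ← Complex.exp_nat_mul, dotProduct_mulVec_eq_sum_eigenvalues hV.isHermitian]
  congr 1
  simp_rw [mul_pow, Real.sq_sqrt (div_nonneg (hV.eigenvalues_nonneg _) (Nat.cast_nonneg N)),
    real_inner_smul_left, real_inner_smul_right, mul_pow]
  have e : ∑ i, hV.isHermitian.eigenvalues i * ((1 / (N : ℝ)) ^ 2 *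
        ⟪hV.isHermitian.eigenvectorBasis i, t⟫ ^ 2) =
      (1 / (N : ℝ)) * ∑ i, hV.isHermitian.eigenvalues i / N *
        ⟪hV.isHermitian.eigenvectorBasis i, t⟫ ^ 2 := by
    rw [Finset.mul_sum]
    exact Finset.sum_congr rfl fun i _ => by ring
  rw [e]
  push_cast
  simp only [Finset.card_univ, Fintype.card_fin]
  field_simp

/-! ### The test direction and the numerical threshold. -/

/-- If the support function of `G = ∑ i, √(a i) * g i * b i` is at most `R` times the
directional standard deviation plus `S`, then testing against the direction with coefficients
`min (a i) s / √(a i) * g i` bounds the truncated quadratic form. -/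
lemma sqrt_sum_min_mul_sq_le {ι E : Type*} [Fintype ι] [NormedAddCommGroup E]
    [InnerProductSpace ℝ E] (b : OrthonormalBasis ι ℝ E) {a : ι → ℝ} (ha : ∀ i, 0 ≤ a i)
    {s R S : ℝ} (hs : 0 ≤ s) (hR : 0 ≤ R) (hS : 0 ≤ S) (g : ι → ℝ)
    (h : ∀ u : E, ‖u‖ = 1 →
      ⟪∑ i, (√(a i) * g i) • b i, u⟫ ≤ R * √(∑ i, a i * ⟪b i, u⟫ ^ 2) + S) :
    √(∑ i, min (a i) s * g i ^ 2) ≤ R * √s + S := by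
  set G := ∑ i, (√(a i) * g i) • b i with hG
  -- Homogeneity removes the normalisation, so the test vector need not have norm one.
  have hhom : ∀ v : E, ⟪G, v⟫ ≤ R * √(∑ i, a i * ⟪b i, v⟫ ^ 2) + S * ‖v‖ := by
    intro v
    rcases eq_or_ne v 0 with rfl | hv
    · simp
    have hv' : 0 < ‖v‖ := norm_pos_iff.2 hv
    have h1 := h (‖v‖⁻¹ • v) (norm_smul_inv_norm hv)
    have h2 : ∑ i, a i * ⟪b i, ‖v‖⁻¹ • v⟫ ^ 2 = (‖v‖⁻¹) ^ 2 * ∑ i, a i * ⟪b i, v⟫ ^ 2 := by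
      rw [Finset.mul_sum]
      refine Finset.sum_congr rfl fun i _ => ?_
      rw [real_inner_smul_right]
      ring
    rw [h2, Real.sqrt_mul (sq_nonneg _), Real.sqrt_sq (inv_nonneg.2 hv'.le),
      real_inner_smul_right] at h1
    have h3 := mul_le_mul_of_nonneg_left h1 hv'.le
    field_simp at h3
    linarith
  have hτ : ∀ i, 0 ≤ min (a i) s := fun i => le_min (ha i) hs
  set Q := ∑ i, min (a i) s * g i ^ 2 with hQ
  have hQ0 : 0 ≤ Q := Finset.sum_nonneg fun i _ => mul_nonneg (hτ i) (sq_nonneg _)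
  set v : E := ∑ i, (min (a i) s / √(a i) * g i) • b i with hv
  have hbv : ∀ i, ⟪b i, v⟫ = min (a i) s / √(a i) * g i := fun i =>
    b.orthonormal.inner_right_fintype _ i
  have hmul : ∀ i, √(a i) * (min (a i) s / √(a i)) = min (a i) s := by
    intro i
    rcases (ha i).eq_or_lt with h0 | h0
    -- When `a i = 0`, division by zero gives `0`, which agrees with `min 0 s = 0`.
    · rw [← h0]; simp [hs]
    · have := (Real.sqrt_pos.2 h0).ne'
      field_simp
  have hGv : ⟪G, v⟫ = Q := by
    rw [hG, sum_inner, hQ]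
    refine Finset.sum_congr rfl fun i _ => ?_
    rw [real_inner_smul_left, hbv]
    linear_combination g i ^ 2 * hmul i
  have hvar : ∑ i, a i * ⟪b i, v⟫ ^ 2 ≤ s * Q := by
    rw [hQ, Finset.mul_sum]
    refine Finset.sum_le_sum fun i _ => ?_
    have : a i * ⟪b i, v⟫ ^ 2 = min (a i) s * (min (a i) s * g i ^ 2) := by
      calc a i * ⟪b i, v⟫ ^ 2 = √(a i) ^ 2 * (min (a i) s / √(a i) * g i) ^ 2 := by
            rw [hbv, Real.sq_sqrt (ha i)]
        _ = (√(a i) * (min (a i) s / √(a i))) ^ 2 * g i ^ 2 := by ring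
        _ = min (a i) s * (min (a i) s * g i ^ 2) := by rw [hmul i]; ring
    rw [this]
    exact mul_le_mul_of_nonneg_right (min_le_right _ _) (mul_nonneg (hτ i) (sq_nonneg _))
  have hnorm : ‖v‖ ^ 2 ≤ Q := by
    rw [← b.sum_sq_norm_inner_right, hQ]
    refine Finset.sum_le_sum fun i _ => ?_
    rw [hbv, Real.norm_eq_abs, sq_abs, mul_pow]
    refine mul_le_mul_of_nonneg_right ?_ (sq_nonneg _)
    rw [div_pow, Real.sq_sqrt (ha i)]
    refine div_le_of_le_mul₀ (ha i) (hτ i) ?_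
    rw [sq]
    exact mul_le_mul_of_nonneg_left (min_le_left _ _) (hτ i)
  rcases hQ0.eq_or_lt with h0 | h0
  · rw [← h0, Real.sqrt_zero]
    positivity
  have hsq := Real.sqrt_pos.2 h0
  have key : √Q * √Q ≤ (R * √s + S) * √Q := by
    calc √Q * √Q = ⟪G, v⟫ := by rw [Real.mul_self_sqrt hQ0, hGv]
      _ ≤ R * √(∑ i, a i * ⟪b i, v⟫ ^ 2) + S * ‖v‖ := hhom v
      _ ≤ R * √(s * Q) + S * √Q := by
        gcongr
        exact Real.le_sqrt_of_sq_le hnorm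
      _ = (R * √s + S) * √Q := by rw [Real.sqrt_mul hs]; ring
  exact le_of_mul_le_mul_right key hsq

/-- The exponent in the Chernoff bound is below `-log 2` at the relevant threshold. -/
lemma threshold_exponent_lt {C L k x t M : ℝ} (hL : Real.log 2 ≤ L) (hx : 0 < x) (hxt : x ≤ t)
    (hk1 : 1 ≤ k) (hk : (2 * C + √2) ^ 2 * L ≤ k) (hM : k * x ^ 2 + t ^ 2 ≤ M) :
    3 / 2 * (max C 0 * √L * x + 1 / 4 * t) ^ 2 - Real.log 2 * M < -(Real.log 2 * x ^ 2) := by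
  have l1 := Real.log_two_gt_d9
  have l2 := Real.log_two_lt_d9
  have hL0 : 0 ≤ L := by linarith
  have hx2 : 0 < x ^ 2 := by positivity
  have hxt2 : x ^ 2 ≤ t ^ 2 := by gcongr
  have hlM : Real.log 2 * (k * x ^ 2 + t ^ 2) ≤ Real.log 2 * M := by gcongr
  rcases le_or_gt C 0 with hC | hC
  · rw [max_eq_right hC]
    have h1 : Real.log 2 * (1 * x ^ 2) ≤ Real.log 2 * (k * x ^ 2) := by gcongr
    have h2 : 0.6 * t ^ 2 ≤ Real.log 2 * t ^ 2 := by gcongr; linarith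
    nlinarith
  · rw [max_eq_left hC.le]
    set r := C * √L * x with hr
    have hr2 : r ^ 2 = C ^ 2 * L * x ^ 2 := by
      rw [hr, mul_pow, mul_pow, Real.sq_sqrt hL0]
    have hexp : (2 * C + √2) ^ 2 * L = 4 * C ^ 2 * L + 2 * L + 4 * √2 * C * L := by
      have := Real.sq_sqrt (zero_le_two (α := ℝ))
      linear_combination L * this
    have hk' : 4 * C ^ 2 * L + 2 * L ≤ k := by
      have : 0 ≤ 4 * √2 * C * L := by positivity
      linarith
    have hkx : 4 * r ^ 2 + 2 * L * x ^ 2 ≤ k * x ^ 2 := by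
      rw [hr2]
      calc _ = (4 * C ^ 2 * L + 2 * L) * x ^ 2 := by ring
        _ ≤ _ := by gcongr
    -- Cauchy–Schwarz with weights `1/2` and `1/4`, since `1/4 + 1/16 = 5/16`. The proof closes
    -- because `3/2 * 5/16 < 0.6 < log 2`.
    have hq : (r + 1 / 4 * t) ^ 2 ≤ 5 / 16 * (4 * r ^ 2 + t ^ 2) := by
      nlinarith [sq_nonneg (r - t)]
    have hLx : 0.69 * x ^ 2 ≤ L * x ^ 2 := by gcongr; linarith
    have hb : 4 * r ^ 2 + t ^ 2 + 1.38 * x ^ 2 ≤ k * x ^ 2 + t ^ 2 := by linarith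
    have h3 : Real.log 2 * (4 * r ^ 2 + t ^ 2 + 1.38 * x ^ 2) ≤
        Real.log 2 * (k * x ^ 2 + t ^ 2) := by gcongr
    have h4 : 0.6 * (4 * r ^ 2 + t ^ 2 + 0.38 * x ^ 2) ≤
        Real.log 2 * (4 * r ^ 2 + t ^ 2 + 0.38 * x ^ 2) := by gcongr; linarith
    nlinarith [sq_nonneg r]

/-- The lower bound in the eigenbasis: `a` are the (rescaled) eigenvalues, `J` is the set of
indices of the tail and `s` is the largest eigenvalue in the tail. -/
lemma sqrt_sum_tail_le_of_measure {ι E : Type*} [Fintype ι] [DecidableEq ι] [NormedAddCommGroup E]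
    [InnerProductSpace ℝ E] (b : OrthonormalBasis ι ℝ E) {a : ι → ℝ} (ha : ∀ i, 0 ≤ a i)
    {s C L S : ℝ} (hs : 0 < s) (hL : Real.log 2 ≤ L) (hS : 0 ≤ S) {J : Finset ι}
    (hJ : ∀ i ∈ J, a i ≤ s) (hJc : ∀ i ∉ J, s ≤ a i) (hsJ : s ≤ ∑ i ∈ J, a i)
    (hk1 : (1 : ℝ) ≤ (Jᶜ).card) (hk : (2 * C + √2) ^ 2 * L ≤ (Jᶜ).card)
    (hprob : 1 / 2 ≤ (Measure.pi fun _ : ι => gaussianReal 0 1).real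
      {g | ∀ u : E, ‖u‖ = 1 →
        ⟪∑ i, (√(a i) * g i) • b i, u⟫ ≤ C * √((∑ i, a i * ⟪b i, u⟫ ^ 2) * L) + S}) :
    1 / 4 * √(∑ i ∈ J, a i) ≤ S := by
  by_contra! hlt
  set T := ∑ i ∈ J, a i with hT
  have hL0 : 0 ≤ L := (Real.log_nonneg one_le_two).trans hL
  have hsum : (Jᶜ).card * √s ^ 2 + √T ^ 2 ≤ ∑ i, min (a i) s := by
    rw [Real.sq_sqrt hs.le, Real.sq_sqrt (hs.le.trans hsJ), ← Finset.sum_add_sum_compl J,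
      add_comm, hT]
    refine add_le_add (Finset.sum_le_sum fun i hi => (le_min le_rfl (hJ i hi))) ?_
    rw [← nsmul_eq_mul]
    exact Finset.card_nsmul_le_sum _ _ _ fun i hi =>
      le_min (hJc i (Finset.mem_compl.1 hi)) le_rfl
  have hexp := threshold_exponent_lt hL (Real.sqrt_pos.2 hs) (Real.sqrt_le_sqrt hsJ) hk1 hk hsum
  set q := (max C 0 * √L * √s + 1 / 4 * √T) ^ 2 with hq
  rw [Real.sq_sqrt hs.le] at hexp
  -- Dividing by `s` puts the weights in `[0, 1]`, as the Chernoff bound requires.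
  have hchern := measureReal_pi_gaussianReal_sum_mul_sq_le (t := fun i => min (a i) s / s)
    (fun i => div_nonneg (le_min (ha i) hs.le) hs.le)
    (fun i => div_le_one_of_le₀ (min_le_right _ _) hs.le) (q / s)
  have hsub : {g : ι → ℝ | ∀ u : E, ‖u‖ = 1 →
        ⟪∑ i, (√(a i) * g i) • b i, u⟫ ≤ C * √((∑ i, a i * ⟪b i, u⟫ ^ 2) * L) + S} ⊆
      {g | ∑ i, min (a i) s / s * g i ^ 2 ≤ q / s} := by
    intro g hg
    -- `C` may be negative; replacing it by `max C 0` only weakens the bound.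
    have h1 := sqrt_sum_min_mul_sq_le b ha hs.le (R := max C 0 * √L) (by positivity) hS g
      fun u hu => by
        refine (hg u hu).trans (add_le_add_left ?_ S)
        rw [mul_comm _ L, Real.sqrt_mul hL0, ← mul_assoc]
        gcongr
        exact le_max_left _ _
    have h2 : ∑ i, min (a i) s * g i ^ 2 ≤ q := by
      rw [hq]
      exact (Real.sqrt_le_left (by positivity)).1 (h1.trans (by linarith))
    simp only [Set.mem_ofPred_eq, div_mul_eq_mul_div, ← Finset.sum_div]
    gcongr
  have hle := hprob.trans ((measureReal_mono hsub).trans hchern)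
  rw [← Finset.sum_div] at hle
  have hneg : 3 / 2 * (q / s) - Real.log 2 * ((∑ i, min (a i) s) / s) < -Real.log 2 := by
    have : 3 / 2 * (q / s) - Real.log 2 * ((∑ i, min (a i) s) / s) =
        (3 / 2 * q - Real.log 2 * ∑ i, min (a i) s) / s := by ring
    rw [this, div_lt_iff₀ hs]
    linarith
  have := hle.trans_lt (Real.exp_lt_exp.2 hneg)
  rw [Real.exp_neg, Real.exp_log two_pos] at this
  norm_num at this

/-! ### Counting indices and assembling the result. -/

/-- If `k` lies strictly below some index, at least `⌊k⌋₊` indices of `Fin n` are not above it. -/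
lemma floor_le_card_filter_add_one_le {n : ℕ} {k : ℝ} (hk : 0 ≤ k) (j : Fin n)
    (hj : k < (j.val : ℝ) + 1) :
    (⌊k⌋₊ : ℝ) ≤ (Finset.univ.filter fun i : Fin n => ¬ k < (i.val : ℝ) + 1).card := by
  have hjn : ⌊k⌋₊ ≤ n := by
    have : ⌊k⌋₊ < j.val + 1 := (Nat.floor_lt hk).2 (by exact_mod_cast hj)
    omega
  rw [Nat.cast_le]
  calc ⌊k⌋₊ = (Finset.univ.image (Fin.castLE hjn)).card := by
        rw [Finset.card_image_of_injective _ (Fin.castLE_injective hjn), Finset.card_univ,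
          Fintype.card_fin]
    _ ≤ _ := by
        refine Finset.card_le_card fun i hi => ?_
        obtain ⟨l, -, rfl⟩ := Finset.mem_image.1 hi
        have : ((l.val + 1 : ℕ) : ℝ) ≤ k :=
          (Nat.cast_le.2 (Nat.succ_le_of_lt l.isLt)).trans (Nat.floor_le hk)
        simp only [Finset.mem_filter, Finset.mem_univ, true_and, not_lt, Fin.val_castLE]
        exact_mod_cast this

theorem proposition2 (C : ℝ) :
    ∃ C' : ℝ, 0 < C' ∧
      ∀ (d N : ℕ), 0 < N →
      ∀ (μ : EuclideanSpace ℝ (Fin d)) (V : Matrix (Fin d) (Fin d) ℝ) (hV : V.PosSemidef)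
        (δ : ℝ), 0 < δ → δ ≤ 1 / 2 →
      ∀ (S : ℝ), 0 ≤ S →
      ∀ (Ω : Type*) [MeasurableSpace Ω] (P : Measure Ω) [IsProbabilityMeasure P]
        (X : Fin N → Ω → EuclideanSpace ℝ (Fin d)),
        (∀ i, HasLaw (X i) (multivariateGaussian μ V) P) →
        iIndepFun X P →
        ENNReal.ofReal (1 - δ) ≤
          P {ω | ∀ u : EuclideanSpace ℝ (Fin d), ‖u‖ = 1 →
            ⟪empiricalMean (fun i => X i ω) - μ, u⟫ ≤
              C * √(directionalVariance (multivariateGaussian μ V) u * Real.log (1 / δ) / N)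
                + S} →
        C' * √(eigenvalueTailSum hV.isHermitian
            (1 + (2 * C + √2) ^ 2 * Real.log (1 / δ)) / N) ≤ S := by
  refine ⟨1 / 4, by norm_num, ?_⟩
  intro d N hN μ V hV δ hδ hδ2 S hS Ω _ P _ X hX hind hP
  set L := Real.log (1 / δ) with hLdef
  have hL : Real.log 2 ≤ L :=
    Real.log_le_log two_pos ((le_div_iff₀ hδ).2 (by linarith))
  have hL0 : 0 ≤ L := (Real.log_nonneg one_le_two).trans hL
  set k := 1 + (2 * C + √2) ^ 2 * L with hkdef
  have hk1 : 1 ≤ k := le_add_of_nonneg_right (mul_nonneg (sq_nonneg _) hL0)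
  have hN0 : (0 : ℝ) < N := by exact_mod_cast hN
  set e : Fin (Fintype.card (Fin d)) ≃ Fin d :=
    Fintype.equivOfCardEq (Fintype.card_fin _) with he
  set lam := hV.isHermitian.eigenvalues with hlam
  have hlam0 : ∀ i, 0 ≤ lam i := hV.eigenvalues_nonneg
  have hlame : ∀ i, hV.isHermitian.eigenvalues₀ i = lam (e i) := fun i => by
    rw [hlam, Matrix.IsHermitian.eigenvalues, ← he, Equiv.symm_apply_apply]
  set J₀ := Finset.univ.filter fun i : Fin (Fintype.card (Fin d)) => k < (i.val : ℝ) + 1 with hJ₀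
  set J : Finset (Fin d) := J₀.map e.toEmbedding with hJ
  have hmemJ : ∀ i, e i ∈ J ↔ k < (i.val : ℝ) + 1 := fun i => by simp [hJ, hJ₀]
  have htail : eigenvalueTailSum hV.isHermitian k / N = ∑ i ∈ J, lam i / N := by
    rw [eigenvalueTailSum, hJ, Finset.sum_map, Finset.sum_div]
    exact Finset.sum_congr rfl fun i _ => by rw [hlame]; rfl
  rw [htail]
  rcases J₀.eq_empty_or_nonempty with hempty | hne
  · rw [hJ, hempty]
    simpa using hS
  -- The first tail index carries the largest tail eigenvalue, which is the truncation level.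
  set j := J₀.min' hne with hj
  have hjJ₀ : j ∈ J₀ := J₀.min'_mem hne
  have hjk : k < (j.val : ℝ) + 1 := (Finset.mem_filter.1 hjJ₀).2
  have hcard : (⌊k⌋₊ : ℝ) ≤ (Jᶜ).card := by
    refine (floor_le_card_filter_add_one_le (by linarith) j hjk).trans (le_of_eq ?_)
    congr 1
    rw [Finset.card_compl, hJ, Finset.card_map, Finset.filter_not, Finset.card_sdiff_of_subset
      (Finset.subset_univ _), Finset.card_univ, Fintype.card_fin]
  have hJle : ∀ i ∈ J, lam i ≤ lam (e j) := by
    intro i hi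
    obtain ⟨l, rfl⟩ := e.surjective i
    rw [← hlame, ← hlame]
    exact hV.isHermitian.eigenvalues₀_antitone
      (J₀.min'_le l (by simpa [hJ₀] using (hmemJ l).1 hi))
  have hJge : ∀ i ∉ J, lam (e j) ≤ lam i := by
    intro i hi
    obtain ⟨l, rfl⟩ := e.surjective i
    rw [← hlame, ← hlame]
    refine hV.isHermitian.eigenvalues₀_antitone (Fin.le_def.2 ?_)
    rw [hmemJ, not_lt] at hi
    have : (l.val : ℝ) < j.val := by linarith
    exact_mod_cast this.le
  rcases (hlam0 (e j)).eq_or_lt with hz | hpos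
  · rw [Finset.sum_eq_zero fun i hi => by
      rw [le_antisymm (hz ▸ hJle i hi) (hlam0 i), zero_div]]
    simpa using hS
  refine sqrt_sum_tail_le_of_measure (C := C) (L := L) hV.isHermitian.eigenvectorBasis
    (fun i => div_nonneg (hlam0 i) hN0.le) (div_pos hpos hN0) hL hS
    (fun i hi => by have := hJle i hi; gcongr) (fun i hi => by have := hJge i hi; gcongr)
    (Finset.single_le_sum (f := fun i => lam i / N) (fun i _ => div_nonneg (hlam0 i) hN0.le)
      ((hmemJ j).2 hjk)) ?_ ?_ ?_
  · refine le_trans ?_ hcard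
    exact_mod_cast (Nat.one_le_floor_iff k).2 hk1
  -- The summand `1` in `k` pays for the floor: `⌊k⌋₊ > k - 1`.
  · have := Nat.lt_floor_add_one k
    linarith
  set A : Set (EuclideanSpace ℝ (Fin d)) := {x | ∀ u : EuclideanSpace ℝ (Fin d), ‖u‖ = 1 →
    ⟪x - μ, u⟫ ≤ C * √(directionalVariance (multivariateGaussian μ V) u * L / N) + S} with hA
  -- `A` is an intersection of closed half-spaces, so its probability depends only on the law of the
  -- mean.
  have hAm : MeasurableSet A := by
    refine IsClosed.measurableSet ?_
    simp only [hA, Set.ofPred_forall]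
    exact isClosed_iInter fun u => isClosed_iInter fun _ =>
      isClosed_le (by fun_prop) continuous_const
  have hmean : AEMeasurable (fun ω => empiricalMean fun i => X i ω) P :=
    (Finset.aemeasurable_fun_sum _ fun i _ => (hX i).aemeasurable).const_smul (1 / (N : ℝ))
  have hP' : ENNReal.ofReal (1 - δ) ≤ P.map (fun ω => empiricalMean fun i => X i ω) A := by
    rw [Measure.map_apply_of_aemeasurable hmean hAm]
    exact hP
  rw [map_empiricalMean_multivariateGaussian hN hV hX hind,
    Measure.map_apply (by fun_prop) hAm] at hP'
  have hset : {g : Fin d → ℝ | ∀ u : EuclideanSpace ℝ (Fin d), ‖u‖ = 1 →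
      ⟪∑ i, (√(lam i / N) * g i) • hV.isHermitian.eigenvectorBasis i, u⟫ ≤
        C * √((∑ i, lam i / N * ⟪hV.isHermitian.eigenvectorBasis i, u⟫ ^ 2) * L) + S} =
      (fun g : Fin d → ℝ => μ + ∑ i, (√(hV.isHermitian.eigenvalues i / N) * g i) •
          hV.isHermitian.eigenvectorBasis i) ⁻¹' A := by
    ext g
    simp only [hA, Set.mem_ofPred_eq, Set.mem_preimage, add_sub_cancel_left,
      directionalVariance_multivariateGaussian μ hV]
    refine forall₂_congr fun u _ => ?_
    have : (∑ i, lam i / N * ⟪hV.isHermitian.eigenvectorBasis i, u⟫ ^ 2) * L =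
        (∑ i, lam i * ⟪hV.isHermitian.eigenvectorBasis i, u⟫ ^ 2) * L / N := by
      simp_rw [div_mul_eq_mul_div, ← Finset.sum_div]
      ring
    rw [this]
  rw [hset]
  have := (ENNReal.ofReal_le_iff_le_toReal (measure_ne_top _ _)).1 hP'
  exact le_trans (by linarith) this
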